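/- Let $K,M,L\ge 1$ be integers. Consider the time-invariant two-cell parallel MIMO interfering multiple access channel with $K$ users per cell, $M$ antennas at each node and $L$ subchannels. The entries of the $M\times M$ channel matrices $\mathbf H^{[r]}_{ck,l}$ from user $k$ of cell $c$ to receiver $r$ on subchannel $l$ ($r,c\in\{1,2\}$, $1\le k\le K$, $1\le l\le L$) are independent, identically distributed complex random variables whose common law is absolutely continuous with respect to Lebesgue measure on $\mathbb C$. Let $\mathbf H^{[r]}_{ck}=\mathrm{blck}(\mathbf H^{[r]}_{ck,1},\dots,\mathbf H^{[r]}_{ck,L})\in\mathbb C^{ML\times ML}$ be the block-diagonal matrix of the subchannels. For $T\ge1$ let $\bar{\mathbf H}^{[r]}_{ck}=\mathrm{blck}(\mathbf H^{[r]}_{ck},\dots,\mathbf H^{[r]}_{ck})\in\mathbb C^{MLT\times MLT}$ ($T$ equal blocks), and let $\bar{\mathcal F}_T$ be the set of $(n_{ck})\in\mathbb Z_{\ge0}^{2K}$ for which there exist matrices $\bar{\mathbf V}_{ck},\bar{\mathbf U}_{ck}\in\mathbb C^{MLT\times n_{ck}}$ with $\mathrm{rank}(\bar{\mathbf U}_{ck}^\dagger\bar{\mathbf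 H}^{[c]}_{ck}\bar{\mathbf V}_{ck})=n_{ck}$ for all $(c,k)$ and $\bar{\mathbf U}_{c'k'}^\dagger\bar{\mathbf H}^{[c']}_{ck}\bar{\mathbf V}_{ck}=\mathbf O$ whenever $(c',k')\neq(c,k)$. Let $\widetilde{\mathcal F}_T$ be defined in the same way with real matrices $\widetilde{\mathbf V}_{ck},\widetilde{\mathbf U}_{ck}\in\mathbb R^{2MLT\times n_{ck}}$ and with $\bar{\mathbf H}^{[r]}_{ck}$ replaced by the real $2MLT\times2MLT$ matrix obtained from it by replacing each entry $z$ by $\begin{pmatrix}\mathrm{Re}\,z&-\mathrm{Im}\,z\\ \mathrm{Im}\,z&\mathrm{Re}\,z\end{pmatrix}$. The largest sum degrees of freedom achieved by linear interference alignment with finite symbol extension, for circularly symmetric signaling (CSS) and asymmetric complex signaling (ACS), are $$d_{\mathrm f,\mathrm{css}}=\max_{T\ge1}\frac1T\max_{(n_{ck})\in\bar{\mathcal F}_T}\sum_{c,k}n_{ck},\qquad d_{\mathrm f,\mathrm{acs}}=\max_{T\ge1}\frac1{2T}\max_{(n_{ck})\in\widetilde{\mathcal F}_T}\sum_{c,k}n_{ck}.$$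 Then, with probability one, these maxima exist (are attained) and $$d_{\mathrm f,\mathrm{css}}=\begin{cases}\dfrac{2KML}{K+1}&\text{if }K\le M^2L,\\[2mm]\dfrac{2M^3L^2}{M^2L+1}&\text{if }K>M^2L,\end{cases}\qquad d_{\mathrm f,\mathrm{acs}}=\begin{cases}\dfrac{2KML}{K+1}&\text{if }K\le 2M^2L,\\[2mm]\dfrac{4M^3L^2}{2M^2L+1}&\text{if }K>2M^2L.\end{cases}$$ -/

import Mathlib

open MeasureTheory ProbabilityTheory
open scoped Matrix

noncomputable section

namespace IMAC

/-- A realization of the channel matrices of the time-invariant two-cell parallel MIMO interfering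
multiple access channel with `K` users per cell, `M` antennas at each node and `L` subchannels:
`H r c k l` is the `M × M` matrix from transmitter `k` in cell `c` to receiver `r` on
subchannel `l`. -/
abbrev Channel (K M L : ℕ) : Type :=
  Fin 2 → Fin 2 → Fin K → Fin L → Matrix (Fin M) (Fin M) ℂ

/-- Indices `(r, c, k, l, i, j)` of the scalar channel coefficients. -/
abbrev CoeffIndex (K M L : ℕ) : Type :=
  Fin 2 × Fin 2 × Fin K × Fin L × Fin M × Fin M

/-- The channel assembled from its scalar coefficients. -/
def Channel.ofCoeffs {K M L : ℕ} (h : CoeffIndex K M L → ℂ) : Channel K M L :=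
  fun r c k l => Matrix.of fun i j => h (r, c, k, l, i, j)

/-- All subchannels considered jointly: `blck (H_{ck,1}^{[r]}, …, H_{ck,L}^{[r]})`. -/
def Channel.joint {K M L : ℕ} (H : Channel K M L) (r c : Fin 2) (k : Fin K) :
    Matrix (Fin M × Fin L) (Fin M × Fin L) ℂ :=
  Matrix.blockDiagonal fun l => H r c k l

/-- The real form of a complex matrix: each entry `z` is replaced by the `2 × 2` real block
`[Re z, -Im z; Im z, Re z]`. -/
def realForm {m n : Type*} (A : Matrix m n ℂ) : Matrix (m × Fin 2) (n × Fin 2) ℝ :=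
  Matrix.of fun p q =>
    !![(A p.1 q.1).re, -(A p.1 q.1).im; (A p.1 q.1).im, (A p.1 q.1).re] p.2 q.2

/-- The `T`-symbol extension of a time-invariant channel matrix: the block-diagonal matrix with
`T` identical blocks. -/
def symbolExt {𝕜 ι : Type*} [Zero 𝕜] (T : ℕ) (A : Matrix ι ι 𝕜) :
    Matrix (ι × Fin T) (ι × Fin T) 𝕜 :=
  Matrix.blockDiagonal fun _ : Fin T => A

/-- The linear interference alignment condition for the matrices `G r c k` (from user `k` in
cell `c` to receiver `r`): there are precoders `V c k` and combiners `U c k` with `n c k` columns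
such that every user's own streams are received with full rank `n c k`, and everything from any
other user (of the same or of the other cell) is nulled. A user with `n c k = 0` is silent. -/
def IAFeasible {𝕜 ι : Type*} [RCLike 𝕜] [Fintype ι] {K : ℕ}
    (G : Fin 2 → Fin 2 → Fin K → Matrix ι ι 𝕜) (n : Fin 2 → Fin K → ℕ) : Prop :=
  ∃ V U : (c : Fin 2) → (k : Fin K) → Matrix ι (Fin (n c k)) 𝕜,
    (∀ c k, ((U c k)ᴴ * G c c k * V c k).rank = n c k) ∧
    ∀ c k c' k', (c', k') ≠ (c, k) → (U c' k')ᴴ * G c' c k * V c k = 0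

/-- Feasible stream allocations of the circularly-symmetric-signaling (CSS) system with
`T`-symbol extension (complex precoders and combiners). -/
def feasibleCSS {K M L : ℕ} (H : Channel K M L) (T : ℕ) : Set (Fin 2 → Fin K → ℕ) :=
  {n | IAFeasible (fun r c k => symbolExt T (H.joint r c k)) n}

/-- Feasible stream allocations of the asymmetric-complex-signaling (ACS) system with
`T`-symbol extension (real precoders and combiners for the real form of the channel). -/
def feasibleACS {K M L : ℕ} (H : Channel K M L) (T : ℕ) : Set (Fin 2 → Fin K → ℕ) :=
  {n | IAFeasible (fun r c k => symbolExt T (realForm (H.joint r c k))) n}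

/-- The sum DoF achieved by CSS linear interference alignment over all finite symbol extensions
`T ≥ 1`: `(1 / T) ∑ n_{ck}`. -/
def achievableCSS {K M L : ℕ} (H : Channel K M L) : Set ℝ :=
  {d | ∃ T : ℕ, 0 < T ∧ ∃ n ∈ feasibleCSS H T,
    d = 1 / (T : ℝ) * ∑ c : Fin 2, ∑ k : Fin K, (n c k : ℝ)}

/-- The sum DoF achieved by ACS linear interference alignment over all finite symbol extensions
`T ≥ 1`: `(1 / (2 T)) ∑ n_{ck}`, since a real stream provides half a degree of freedom. -/
def achievableACS {K M L : ℕ} (H : Channel K M L) : Set ℝ :=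
  {d | ∃ T : ℕ, 0 < T ∧ ∃ n ∈ feasibleACS H T,
    d = 1 / (2 * (T : ℝ)) * ∑ c : Fin 2, ∑ k : Fin K, (n c k : ℝ)}

end IMAC

end

/-! Write `ι` for the index set of one channel use, and let `D` be the dimension, over the scalar
field, of the space of block-diagonal channel matrices: `M ^ 2 * L` over ℂ for CSS, `2 * M ^ 2 * L`
over ℝ for ACS. With `κ = min K D`, both formulas say that the optimum is `2κ/(κ+1)` times `card ι`,
halved in the real case.

Upper bound (`IAFeasible.sum_le`). Let `S_c` be the number of streams of cell `c` and `d_c` the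
dimension of the interference that cell `c` causes at the other receiver. Desired signals and
interference share a space of dimension `card ι * T`, so `S_r + d_c ≤ card ι * T` for `r ≠ c`. Also
`S_c ≤ κ d_c`: cross channels are invertible, so each of the `K` users has at most `d_c` streams;
and the quotients of direct by cross channels lie in a `D`-dimensional space, so all desired signals
lie in the image of that space tensored with the interference. Eliminating `d_c` gives the bound.

Attainment (`iaFeasible_of_det_ne_zero`). Take `T = κ + 1` and let `κ` users per cell send `card ι`
streams each. Precoding by the adjugate of the cross channel aligns the interference of a whole cell
onto the columns of one matrix. Decoding is possible at both receivers once two square determinants,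
each built by `alignMatrix`, do not vanish.

These determinants are polynomials in the channel coefficients and the entries of the aligned
matrices, so one nonvanishing example per receiver suffices (`exists_generic_precoders`), and it may
be sought in an extension field. `exists_det_alignMatrix_ne_zero` constructs it from Vandermonde
systems. For ACS, the real form splits over ℂ into two independent blocks, so the same construction
applies with `2 * L` subchannels. Finally, the zero set of a nonzero polynomial is null for
independent coefficients with absolutely continuous law (`ae_pi_eval_ne_zero`). -/

namespace IMAC

/-! ### Null zero sets of polynomials under product measures -/

/-- A nonzero polynomial in two groups of variables that vanishes almost nowhere in each group
separately vanishes almost nowhere jointly. -/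
theorem ae_prod_eval_ne_zero {𝕜 E₁ E₂ δ₁ δ₂ : Type*} [RCLike 𝕜]
    [MeasurableSpace E₁] [MeasurableSpace E₂] {μ₁ : Measure E₁} {μ₂ : Measure E₂}
    [SFinite μ₁] [SFinite μ₂] [Countable δ₁] [Countable δ₂]
    {φ₁ : E₁ → δ₁ → 𝕜} {φ₂ : E₂ → δ₂ → 𝕜} (hφ₁ : Measurable φ₁) (hφ₂ : Measurable φ₂)
    (H₁ : ∀ q : MvPolynomial δ₁ 𝕜, q ≠ 0 → ∀ᵐ z ∂μ₁, MvPolynomial.eval (φ₁ z) q ≠ 0)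
    (H₂ : ∀ q : MvPolynomial δ₂ 𝕜, q ≠ 0 → ∀ᵐ z ∂μ₂, MvPolynomial.eval (φ₂ z) q ≠ 0)
    (p : MvPolynomial (δ₁ ⊕ δ₂) 𝕜) (hp : p ≠ 0) :
    ∀ᵐ z ∂μ₁.prod μ₂, MvPolynomial.eval (Sum.elim (φ₁ z.1) (φ₂ z.2)) p ≠ 0 := by
  have hm : Measurable fun z : E₁ × E₂ => MvPolynomial.eval (Sum.elim (φ₁ z.1) (φ₂ z.2)) p := by
    refine (MvPolynomial.continuous_eval p).measurable.comp (measurable_pi_lambda _ ?_)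
    rintro (a | a)
    · exact (measurable_pi_apply a).comp (hφ₁.comp measurable_fst)
    · exact (measurable_pi_apply a).comp (hφ₂.comp measurable_snd)
  have hs : MeasurableSet {z : E₁ × E₂ | MvPolynomial.eval (Sum.elim (φ₁ z.1) (φ₂ z.2)) p ≠ 0} :=
    hm (measurableSet_singleton 0).compl
  rw [Measure.ae_prod_iff_ae_ae hs]
  -- Regard `p` as a polynomial in the second group with coefficients in the first. Some coefficient
  -- is nonzero; where it does not vanish, the specialized polynomial in the second group is
  -- nonzero.
  have hswap : MvPolynomial.sumAlgEquiv 𝕜 δ₂ δ₁ (MvPolynomial.rename Sum.swap p) ≠ 0 := by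
    rw [Ne, EmbeddingLike.map_eq_zero_iff]
    exact fun h => hp (MvPolynomial.rename_injective _ Sum.swap_leftInverse.injective (by simpa using h))
  obtain ⟨m, hm⟩ := MvPolynomial.ne_zero_iff.1 hswap
  filter_upwards [H₁ _ hm] with z hz
  have h2 : MvPolynomial.map (MvPolynomial.eval (φ₁ z))
      (MvPolynomial.sumAlgEquiv 𝕜 δ₂ δ₁ (MvPolynomial.rename Sum.swap p)) ≠ 0 := by
    refine MvPolynomial.ne_zero_iff.2 ⟨m, ?_⟩
    rwa [MvPolynomial.coeff_map]
  filter_upwards [H₂ _ h2] with w hw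
  convert hw using 1
  rw [MvPolynomial.eval_map]
  have key : ∀ q : MvPolynomial (δ₁ ⊕ δ₂) 𝕜, MvPolynomial.eval (Sum.elim (φ₁ z) (φ₂ w)) q =
      MvPolynomial.eval₂ (MvPolynomial.eval (φ₁ z)) (φ₂ w)
      (MvPolynomial.sumAlgEquiv 𝕜 δ₂ δ₁ (MvPolynomial.rename Sum.swap q)) := by
    intro q
    induction q using MvPolynomial.induction_on with
    | C a => simp
    | add p q hp hq => simp [hp, hq]
    | mul_X p i hp =>
      rcases i with i | i <;> simp [hp]
  exact key p

/-- Induction by splitting off one factor. The map `φ` lets one factor carry several variables, so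
that a complex coefficient can supply its real and imaginary parts. -/
theorem ae_pi_fin_eval_ne_zero {𝕜 E δ : Type*} [RCLike 𝕜] [MeasurableSpace E] {μ : Measure E}
    [SigmaFinite μ] [Countable δ] {φ : E → δ → 𝕜} (hφ : Measurable φ)
    (H : ∀ q : MvPolynomial δ 𝕜, q ≠ 0 → ∀ᵐ z ∂μ, MvPolynomial.eval (φ z) q ≠ 0) (n : ℕ) :
    ∀ p : MvPolynomial (Fin n × δ) 𝕜, p ≠ 0 →
      ∀ᵐ z ∂Measure.pi fun _ : Fin n => μ,
        MvPolynomial.eval (fun x : Fin n × δ => φ (z x.1) x.2) p ≠ 0 := by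
  induction n with
  | zero =>
    intro p hp
    refine Filter.Eventually.of_forall fun z h => hp ?_
    refine MvPolynomial.funext fun x => ?_
    rw [map_zero, ← h]
    congr 2
    exact Subsingleton.elim _ _
  | succ n ih =>
    intro p hp
    let f : Fin (n + 1) × δ → δ ⊕ (Fin n × δ) := fun x =>
      Fin.cases (Sum.inl x.2) (fun i => Sum.inr (i, x.2)) x.1
    have hf : Function.Injective f := by
      rintro ⟨i, d⟩ ⟨j, e⟩ h
      induction i using Fin.cases <;> induction j using Fin.cases <;> simp_all [f]
    have hp' : MvPolynomial.rename f p ≠ 0 := fun h =>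
      hp (MvPolynomial.rename_injective _ hf (by simpa using h))
    have hφn : Measurable fun (z : Fin n → E) (x : Fin n × δ) => φ (z x.1) x.2 :=
      measurable_pi_lambda _ fun x =>
        (measurable_pi_apply x.2).comp (hφ.comp (measurable_pi_apply x.1))
    have h := ae_prod_eval_ne_zero hφ hφn H ih _ hp'
    have mp := measurePreserving_piFinSuccAbove (fun _ : Fin (n + 1) => μ) 0
    have h3 := mp.quasiMeasurePreserving.ae h
    filter_upwards [h3] with z hz
    rw [MvPolynomial.eval_rename] at hz
    convert hz using 3 with x
    ext x
    obtain ⟨i, d⟩ := x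
    induction i using Fin.cases <;> simp [f, MeasurableEquiv.piFinSuccAbove, Fin.tail]

/-- The zero set of a nonzero polynomial is null for a product measure, if the analogous statement
holds for each factor. -/
theorem ae_pi_eval_ne_zero {𝕜 E δ ι : Type*} [RCLike 𝕜] [MeasurableSpace E] {μ : Measure E}
    [SigmaFinite μ] [Countable δ] [Fintype ι] {φ : E → δ → 𝕜} (hφ : Measurable φ)
    (H : ∀ q : MvPolynomial δ 𝕜, q ≠ 0 → ∀ᵐ z ∂μ, MvPolynomial.eval (φ z) q ≠ 0)
    (p : MvPolynomial (ι × δ) 𝕜) (hp : p ≠ 0) :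
    ∀ᵐ z ∂Measure.pi fun _ : ι => μ,
      MvPolynomial.eval (fun x : ι × δ => φ (z x.1) x.2) p ≠ 0 := by
  let e := Fintype.equivFin ι
  have hp' : MvPolynomial.rename (Prod.map e id) p ≠ 0 := fun h =>
    hp (MvPolynomial.rename_injective _ (e.injective.prodMap Function.injective_id) (by simpa using h))
  have h := ae_pi_fin_eval_ne_zero hφ H _ _ hp'
  have mp := measurePreserving_piCongrLeft (fun _ : Fin (Fintype.card ι) => μ) e
  filter_upwards [mp.quasiMeasurePreserving.ae h] with z hz
  rw [MvPolynomial.eval_rename] at hz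
  convert hz using 3 with x
  ext x
  simp [MeasurableEquiv.piCongrLeft]

theorem ae_eval_ne_zero_of_nullSingletonClass {𝕜 : Type*} [RCLike 𝕜] {μ : Measure 𝕜} [NullSingletonClass μ]
    (q : MvPolynomial Unit 𝕜) (hq : q ≠ 0) : ∀ᵐ z ∂μ, MvPolynomial.eval (fun _ => z) q ≠ 0 := by
  have hq' : MvPolynomial.uniqueAlgEquiv 𝕜 Unit q ≠ 0 := by
    rwa [Ne, EmbeddingLike.map_eq_zero_iff]
  have hfin := (Polynomial.rootSet_finite (MvPolynomial.uniqueAlgEquiv 𝕜 Unit q) 𝕜).countable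
  filter_upwards [compl_mem_ae_iff.2 (hfin.measure_zero μ)] with z hz h
  refine hz ((Polynomial.mem_rootSet_of_ne hq').2 ?_)
  rw [← h, Polynomial.aeval_def]
  exact MvPolynomial.eval₂_uniqueAlgEquiv (f := q) (φ := RingHom.id 𝕜) (a := fun _ => z)

theorem ae_eval_reim_ne_zero (q : MvPolynomial (Fin 2) ℝ) (hq : q ≠ 0) :
    ∀ᵐ z : ℂ, MvPolynomial.eval ![z.re, z.im] q ≠ 0 := by
  have hp' : MvPolynomial.rename (fun i => (i, ())) q ≠ 0 := fun h =>
    hq (MvPolynomial.rename_injective (fun i : Fin 2 => (i, ())) (fun a b h => by simpa using h)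
      (by simpa using h))
  have h := ae_pi_eval_ne_zero (μ := (volume : Measure ℝ)) (φ := fun x (_ : Unit) => x)
    (by fun_prop) (fun q hq => ae_eval_ne_zero_of_nullSingletonClass q hq) _ hp'
  filter_upwards [Complex.volume_preserving_equiv_pi.quasiMeasurePreserving.ae h] with z hz
  rw [MvPolynomial.eval_rename] at hz
  have hx : ((fun x : Fin 2 × Unit => Complex.measurableEquivPi z x.1) ∘ fun i => (i, ())) =
      ![z.re, z.im] := by
    ext i
    fin_cases i <;> simp
  rwa [hx] at hz

end IMAC

/-! ### An explicit channel realization with perfect alignment -/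

namespace IMAC

/-- The time index of the explicit alignment scheme carries a position in the group `I` and an
exponent. -/
def timePos {I : Type*} {κ : ℕ} {S : Finset I} : (I × Fin κ) ⊕ S → I
  | Sum.inl x => x.1
  | Sum.inr i => i

def timeExp {I : Type*} {κ : ℕ} {S : Finset I} : (I × Fin κ) ⊕ S → ℕ
  | Sum.inl x => x.2
  | Sum.inr _ => κ

/-- The direct channels of the explicit alignment scheme: elementary matrices for the users in the
first group, powers of a diagonal matrix with distinct entries for those in the second. -/
def schemeChannel {M κ e : ℕ} {Λ : Type*} [DecidableEq Λ] (h : κ + 1 ≤ M) [NeZero M]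
    (x : Fin M × Λ → ℂ) : ((Fin M × Λ) × Fin κ) ⊕ Fin e → Λ → Matrix (Fin M) (Fin M) ℂ
  | Sum.inl ip, l => Matrix.of fun m m' =>
      if ip.1 = (m, l) ∧ m' = m + Fin.castLE h ip.2.succ then 1 else 0
  | Sum.inr q, l => Matrix.diagonal fun m => x (m, l) ^ (q : ℕ)

/-- The aligned interference of the explicit alignment scheme. -/
def schemePrecoder {M κ : ℕ} {Λ : Type*} [DecidableEq Λ] [Add Λ] {S : Finset (Fin M × Λ)}
    (i : Fin M × Λ) (t : ((Fin M × Λ) × Fin κ) ⊕ S) (j : Fin M × Λ) : ℂ :=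
  if j = timePos t + i then ((i.1 : ℕ) : ℂ) ^ timeExp t else 0

/-- Row `(m, l)` meets the aligned matrix only at antennas `m + s` with `0 ≤ s ≤ κ`: the diagonal
channels all contribute at `s = 0`, and each elementary channel based at `(m, l)` at its own `s ≥
1`. For fixed position, varying the time exponent therefore gives Vandermonde equations in the nodes
`m + s`. -/
theorem scheme_sum_eq {M κ e : ℕ} {Λ : Type*} [Fintype Λ] [DecidableEq Λ] [AddCommGroup Λ]
    [NeZero M] (h : κ + 1 ≤ M) {x : Fin M × Λ → ℂ} {S : Finset (Fin M × Λ)}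
    (c : ((Fin M × Λ) × Fin κ) ⊕ Fin e → Fin M × Λ → ℂ) (m : Fin M) (l : Λ)
    (t : ((Fin M × Λ) × Fin κ) ⊕ S) :
    ∑ k, ∑ m', schemeChannel h x k l m m' * ∑ j, c k j * schemePrecoder (m', l) t j =
      ∑ s : Fin (κ + 1), (Fin.cases (∑ q : Fin e, c (Sum.inr q) (timePos t + (m, l)) * x (m, l) ^ (q : ℕ))
        (fun p => c (Sum.inl ((m, l), p)) (timePos t + (m + Fin.castLE h p.succ, l))) s : ℂ) *
        ((((m + Fin.castLE h s : Fin M) : ℕ) : ℂ)) ^ timeExp t := by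
  rw [Fintype.sum_sum_type, Fin.sum_univ_succ, add_comm]
  congr 1
  · simp only [schemeChannel, schemePrecoder, Matrix.diagonal_apply, ite_mul, zero_mul, mul_ite,
      mul_zero, Finset.sum_ite_eq, Finset.sum_ite_eq', Finset.mem_univ, if_true, Fin.cases_zero,
      Finset.sum_mul]
    refine Finset.sum_congr rfl fun q _ => ?_
    have : (m + Fin.castLE h 0 : Fin M) = m := by
      have : Fin.castLE h 0 = 0 := by ext; simp
      rw [this, add_zero]
    rw [this]; ring
  · rw [Fintype.sum_prod_type, Finset.sum_eq_single (m, l)]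
    · refine Finset.sum_congr rfl fun p _ => ?_
      simp [schemeChannel, schemePrecoder]
    · intro i _ hi
      refine Finset.sum_eq_zero fun p _ => Finset.sum_eq_zero fun m' _ => ?_
      simp [schemeChannel, hi]
    · simp

/-- Two Vandermonde layers: one in the antenna number separates the elementary channels from the
diagonal ones, and one in the diagonal entries `x` then separates the diagonal channels from each
other. -/
theorem eq_zero_of_scheme_eq_zero {M κ e : ℕ} {Λ : Type*} [Fintype Λ] [DecidableEq Λ]
    [AddCommGroup Λ] [NeZero M] (h : κ + 1 ≤ M) {x : Fin M × Λ → ℂ} (hx : Function.Injective x)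
    {S : Finset (Fin M × Λ)} (hS : S.card = e)
    (c : ((Fin M × Λ) × Fin κ) ⊕ Fin e → Fin M × Λ → ℂ)
    (hc : ∀ m l (t : ((Fin M × Λ) × Fin κ) ⊕ S), 
      ∑ k, ∑ m', schemeChannel h x k l m m' * ∑ j, c k j * schemePrecoder (m', l) t j = 0) :
    c = 0 := by
  simp only [scheme_sum_eq] at hc
  have hinj : ∀ m : Fin M, Function.Injective
      fun s : Fin (κ + 1) => (((m + Fin.castLE h s : Fin M) : ℕ) : ℂ) := by
    intro m s s' hs
    simpa [Fin.ext_iff] using add_left_cancel (Fin.val_injective (Nat.cast_injective hs))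
  have hq : ∀ q j, c (Sum.inr q) j = 0 := by
    intro q j
    -- Positions in `S` have the additional exponent `κ`, hence `κ + 1` equations, enough to isolate
    -- the term `s = 0`. The row is chosen as `j - i` so that the diagonal channels see column `j`
    -- for every `i`.
    have hf : ∀ i ∈ S, ∑ q : Fin e, c (Sum.inr q) j * x (j - i) ^ (q : ℕ) = 0 := by
      intro i hi
      have h0 := Matrix.eq_zero_of_forall_pow_sum_mul_pow_eq_zero (hinj (j - i).1)
        (v := fun s => (Fin.cases
          (∑ q : Fin e, c (Sum.inr q) (i + (j - i)) * x (j - i) ^ (q : ℕ))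
          (fun p => c (Sum.inl (j - i, p)) (i + ((j - i).1 + Fin.castLE h p.succ, (j - i).2))) s : ℂ))
        (fun r => ?_)
      · have := congrFun h0 0
        simpa using this
      · induction r using Fin.lastCases with
        | last => exact hc (j - i).1 (j - i).2 (Sum.inr ⟨i, hi⟩)
        | cast r => exact hc (j - i).1 (j - i).2 (Sum.inl (i, r))
    let g : Fin e ≃ S := Fintype.equivOfCardEq (by simp [hS])
    have hv : Matrix.mulVec (Matrix.vandermonde fun r : Fin e => x (j - g r))
        (fun q => c (Sum.inr q) j) = 0 := by
      ext r
      simp only [Matrix.mulVec, dotProduct, Matrix.vandermonde_apply, Pi.zero_apply]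
      rw [← hf (g r) (g r).2]
      exact Finset.sum_congr rfl fun q _ => mul_comm _ _
    refine congrFun (Matrix.eq_zero_of_mulVec_eq_zero (Matrix.det_vandermonde_ne_zero_iff.2 ?_) hv) q
    intro r r' hr
    exact g.injective (Subtype.ext (sub_right_injective (hx hr)))
  funext k j
  rcases k with ⟨⟨m, l⟩, p⟩ | q
  -- With the diagonal terms gone, `κ` unknowns remain, and the exponents `0, …, κ - 1` available at
  -- every position suffice.
  · set i : Fin M × Λ := j - (m + Fin.castLE h p.succ, l) with hi
    have h0 := Matrix.eq_zero_of_forall_pow_sum_mul_pow_eq_zero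
      (f := fun s : Fin κ => (((m + Fin.castLE h s.succ : Fin M) : ℕ) : ℂ))
      ((hinj m).comp (Fin.succ_injective κ))
      (v := fun p => c (Sum.inl ((m, l), p)) (i + (m + Fin.castLE h p.succ, l)))
      (fun r => ?_)
    · have := congrFun h0 p
      simpa [hi] using this
    · have := hc m l (Sum.inl (i, r))
      rw [Fin.sum_univ_succ] at this
      simpa [hq, timePos, timeExp] using this
  · exact hq q j

/-- The square matrix of received signals at one receiver when all interference is aligned to the
columns of `W'`: `W'` followed by the images of `W` under the channels `A k`. -/
def alignMatrix {R ι : Type*} [CommRing R] [Fintype ι] {κ : ℕ} (A : Fin κ → Matrix ι ι R)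
    (W W' : Matrix (ι × Fin (κ + 1)) ι R) : Matrix (ι × Fin (κ + 1)) (ι × Fin (κ + 1)) R :=
  Matrix.of fun p q => Fin.cases (W' p q.1) (fun k => (symbolExt (κ + 1) (A k) * W) p q.1) q.2

/-- The matrix that is block diagonal with blocks `a l` in the coordinates `e`. -/
def blockMatrix {R ι Λ μ : Type*} [Zero R] [DecidableEq Λ] (e : ι ≃ μ × Λ)
    (a : Λ → Matrix μ μ R) : Matrix ι ι R :=
  (Matrix.blockDiagonal a).submatrix e e

theorem symbolExt_mul_apply {R ι α : Type*} [CommRing R] [Fintype ι] {T : ℕ} (A : Matrix ι ι R)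
    (W : Matrix (ι × Fin T) α R) (p : ι × Fin T) (j : α) :
    (symbolExt T A * W) p j = ∑ i, A p.1 i * W (i, p.2) j := by
  obtain ⟨i, t⟩ := p
  simp [symbolExt, Matrix.mul_apply, Matrix.blockDiagonal_apply, Fintype.sum_prod_type]

/-- A channel realization for which perfect interference alignment is possible. -/
theorem exists_det_alignMatrix_ne_zero {M : ℕ} [NeZero M] {Λ ι : Type*} [Fintype Λ] [DecidableEq Λ]
    [AddCommGroup Λ] [Fintype ι] [DecidableEq ι] (E : ι ≃ Fin M × Λ) {K : ℕ} (hK0 : 0 < K)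
    (hK : K ≤ M * (M * Fintype.card Λ)) :
    ∃ (a : Fin K → Λ → Matrix (Fin M) (Fin M) ℂ) (W W' : Matrix (ι × Fin (K + 1)) ι ℂ),
      (alignMatrix (fun k => blockMatrix E (a k)) W W').det ≠ 0 := by
  classical
  set N := M * Fintype.card Λ with hN
  have hNpos : 0 < N := by
    rcases Nat.eq_zero_or_pos N with h | h
    · rw [h] at hK; omega
    · exact h
  have hcard : Fintype.card (Fin M × Λ) = N := by simp [hN]
  -- Division of `K - 1` rather than `K` puts the remainder `e` in `1, …, N`, so that `κ + 1 ≤ M`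
  -- holds even when `K = M * N`.
  obtain ⟨κ, e, hκ, he, hKe⟩ : ∃ κ e, κ + 1 ≤ M ∧ e ≤ N ∧ K = N * κ + e := by
    refine ⟨(K - 1) / N, (K - 1) % N + 1, ?_, Nat.mod_lt _ hNpos, ?_⟩
    · exact Nat.div_lt_of_lt_mul (by rw [mul_comm] at hK; omega)
    · have := Nat.div_add_mod (K - 1) N
      omega
  obtain ⟨S, -, hS⟩ := Finset.exists_subset_card_eq (s := (Finset.univ : Finset (Fin M × Λ)))
    (n := e) (by rw [Finset.card_univ, hcard]; exact he)
  let x : Fin M × Λ → ℂ := fun i => ((Fintype.equivFin _ i : ℕ) : ℂ)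
  have hx : Function.Injective x := fun i j h =>
    (Fintype.equivFin _).injective (Fin.val_injective (Nat.cast_injective h))
  let eK : Fin K ≃ ((Fin M × Λ) × Fin κ) ⊕ Fin e := Fintype.equivOfCardEq (by
    simp only [Fintype.card_fin, Fintype.card_sum, Fintype.card_prod _ (Fin κ), hcard, hKe])
  -- The slot `none` is reserved for the interference: there `W` is zero and `W'` is the identity,
  -- while `W'` vanishes in all other slots. This slot kills the coefficients of `W'`, and the
  -- others form the scheme.
  let eT : Fin (K + 1) ≃ Option (((Fin M × Λ) × Fin κ) ⊕ S) := Fintype.equivOfCardEq (by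
    simp only [Fintype.card_fin, Fintype.card_sum, Fintype.card_prod _ (Fin κ), hcard, hKe,
      Fintype.card_option, Fintype.card_coe, hS])
  refine ⟨fun k => schemeChannel hκ x (eK k),
    Matrix.of fun p j => (eT p.2).elim 0 fun t => schemePrecoder (E p.1) t (E j),
    Matrix.of fun p j => if eT p.2 = none ∧ p.1 = j then 1 else 0, ?_⟩
  intro hdet
  obtain ⟨v, hv0, hv⟩ := Matrix.exists_mulVec_eq_zero_iff.2 hdet
  refine hv0 ?_
  have hrow : ∀ i t, (∑ j, (if eT t = none ∧ i = j then 1 else 0) * v (j, 0)) +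
      ∑ k : Fin K, ∑ i', blockMatrix E (schemeChannel hκ x (eK k)) i i' *
        ∑ j, v (j, k.succ) * ((eT t).elim 0 fun t => schemePrecoder (E i') t (E j)) = 0 := by
    intro i t
    have := congrFun hv (i, t)
    rw [Matrix.mulVec, dotProduct, Fintype.sum_prod_type_right, Fin.sum_univ_succ] at this
    simp only [alignMatrix, Matrix.of_apply, Fin.cases_zero, Fin.cases_succ, symbolExt_mul_apply,
      Pi.zero_apply] at this
    refine Eq.trans ?_ this
    congr 1
    refine Finset.sum_congr rfl fun k _ => ?_
    simp only [Finset.mul_sum, Finset.sum_mul]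
    rw [Finset.sum_comm]
    exact Finset.sum_congr rfl fun _ _ => Finset.sum_congr rfl fun _ _ => by ring
  have h1 : ∀ i, v (i, 0) = 0 := by
    intro i
    have := hrow i (eT.symm none)
    simpa using this
  have h2 : (fun k j => v (E.symm j, (eK.symm k).succ)) = 0 := by
    refine eq_zero_of_scheme_eq_zero hκ hx hS _ fun m l t => ?_
    have := hrow (E.symm (m, l)) (eT.symm (some t))
    simp only [Equiv.apply_symm_apply, reduceCtorEq, false_and, if_false, zero_mul,
      Finset.sum_const_zero, zero_add, Option.elim_some] at this
    rw [← this, ← eK.sum_comp]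
    refine Finset.sum_congr rfl fun k _ => ?_
    rw [← E.symm.sum_comp, Fintype.sum_prod_type]
    refine Finset.sum_congr rfl fun m' _ => ?_
    rw [Finset.sum_eq_single l]
    · simp only [blockMatrix, Matrix.submatrix_apply, Equiv.apply_symm_apply,
        Matrix.blockDiagonal_apply, if_true, Equiv.symm_apply_apply]
      congr 1
      rw [← E.symm.sum_comp]
      simp
    · intro l' _ hl
      simp [blockMatrix, Matrix.blockDiagonal_apply, Ne.symm hl]
    · simp
  funext p
  obtain ⟨j, t⟩ := p
  induction t using Fin.cases with
  | zero => exact h1 j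
  | succ k =>
    have := congrFun (congrFun h2 (eK k)) (E j)
    simpa using this

end IMAC

/-! ### Symbol extensions and precoders that work generically -/

namespace IMAC

theorem symbolExt_mul {R ι : Type*} [CommRing R] [Fintype ι] (T : ℕ) (A B : Matrix ι ι R) :
    symbolExt T (A * B) = symbolExt T A * symbolExt T B := by
  simp [symbolExt, Matrix.blockDiagonal_mul]

theorem symbolExt_one {R ι : Type*} [CommRing R] [DecidableEq ι] (T : ℕ) :
    symbolExt T (1 : Matrix ι ι R) = 1 :=
  Matrix.blockDiagonal_one

theorem symbolExt_smul {R ι : Type*} [CommRing R] (T : ℕ) (s : R) (A : Matrix ι ι R) :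
    symbolExt T (s • A) = s • symbolExt T A := by
  have : (fun _ : Fin T => s • A) = s • fun _ => A := rfl
  rw [symbolExt, this, Matrix.blockDiagonal_smul]
  rfl

theorem symbolExt_add {R ι : Type*} [CommRing R] (T : ℕ) (A B : Matrix ι ι R) :
    symbolExt T (A + B) = symbolExt T A + symbolExt T B := by
  have : (fun _ : Fin T => A + B) = (fun _ => A) + fun _ => B := rfl
  rw [symbolExt, this, Matrix.blockDiagonal_add]
  rfl

theorem det_symbolExt {R ι : Type*} [CommRing R] [Fintype ι] [DecidableEq ι] (T : ℕ)
    (A : Matrix ι ι R) : (symbolExt T A).det = A.det ^ T := by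
  simp [symbolExt, Matrix.det_blockDiagonal]

/-- A common change of basis of the channels changes the alignment determinant only by the factor
`det U ^ (κ + 1)`. -/
theorem alignMatrix_symbolExt_mul {R ι : Type*} [CommRing R] [Fintype ι] {κ : ℕ}
    {A B : Fin κ → Matrix ι ι R} {U : Matrix ι ι R} (hU : ∀ k, A k * U = U * B k)
    (W W' : Matrix (ι × Fin (κ + 1)) ι R) :
    alignMatrix A (symbolExt (κ + 1) U * W) (symbolExt (κ + 1) U * W') =
      symbolExt (κ + 1) U * alignMatrix B W W' := by
  ext p ⟨j, t⟩
  induction t using Fin.cases with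
  | zero => simp [alignMatrix, Matrix.mul_apply]
  | succ k =>
    simp only [alignMatrix, Matrix.of_apply, Fin.cases_succ]
    rw [← Matrix.mul_assoc, ← symbolExt_mul, hU, symbolExt_mul, Matrix.mul_assoc]
    simp [Matrix.mul_apply]

theorem alignMatrix_map {R R' ι : Type*} [CommRing R] [CommRing R'] [Fintype ι] {κ : ℕ}
    (f : R →+* R') (A : Fin κ → Matrix ι ι R) (W W' : Matrix (ι × Fin (κ + 1)) ι R) :
    (alignMatrix A W W').map f = alignMatrix (fun k => (A k).map f) (W.map f) (W'.map f) := by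
  ext p ⟨j, t⟩
  induction t using Fin.cases with
  | zero => simp [alignMatrix]
  | succ k => simp [alignMatrix, symbolExt_mul_apply]

theorem map_det_alignMatrix {R R' ι : Type*} [CommRing R] [CommRing R'] [Fintype ι]
    [DecidableEq ι] {κ : ℕ} (f : R →+* R') (A B : Fin κ → Matrix ι ι R)
    (W W' : Matrix (ι × Fin (κ + 1)) ι R) :
    f (alignMatrix (fun k => A k * (B k).adjugate) W W').det =
      (alignMatrix (fun k => (A k).map f * ((B k).map f).adjugate) (W.map f) (W'.map f)).det := by
  rw [RingHom.map_det, RingHom.mapMatrix_apply, alignMatrix_map]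
  congr 2
  funext k
  rw [Matrix.map_mul]
  congr 1
  exact RingHom.map_adjugate f _

/-- If perfect alignment is possible at each of the two receivers for some channel realization with
coefficients in an extension field, then there are aligned interference spaces that work
simultaneously for both receivers, for all channel realizations outside the zero set of a nonzero
polynomial. -/
theorem exists_generic_precoders {F F' σ ι : Type*} [Field F] [Infinite F] [Field F'] [Algebra F F']
    [Fintype ι] [DecidableEq ι] {κ : ℕ} (D X : Fin 2 → Fin κ → Matrix ι ι (MvPolynomial σ F))
    (hw : ∀ c, ∃ (x : σ → F') (W W' : Matrix (ι × Fin (κ + 1)) ι F'),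
      (alignMatrix (fun k => (D c k).map (MvPolynomial.aeval x) *
        ((X c k).map (MvPolynomial.aeval x)).adjugate) W W').det ≠ 0) :
    ∃ (w : Fin 2 → Matrix (ι × Fin (κ + 1)) ι F) (p : MvPolynomial σ F), p ≠ 0 ∧
      ∀ x : σ → F, MvPolynomial.eval x p ≠ 0 → ∀ c,
        (alignMatrix (fun k => (D c k).map (MvPolynomial.eval x) *
          ((X c k).map (MvPolynomial.eval x)).adjugate) (w c) (w (c + 1))).det ≠ 0 := by
  let τ := Fin 2 × (ι × Fin (κ + 1)) × ι
  let inc : MvPolynomial σ F →+* MvPolynomial (σ ⊕ τ) F := (MvPolynomial.rename Sum.inl).toRingHom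
  let V : Fin 2 → Matrix (ι × Fin (κ + 1)) ι (MvPolynomial (σ ⊕ τ) F) := fun c =>
    Matrix.of fun p j => MvPolynomial.X (Sum.inr (c, p, j))
  let Q : Fin 2 → MvPolynomial (σ ⊕ τ) F := fun c =>
    (alignMatrix (fun k => (D c k).map inc * ((X c k).map inc).adjugate) (V c) (V (c + 1))).det
  have hQ : ∀ c, Q c ≠ 0 := by
    intro c h0
    obtain ⟨x, W, W', h⟩ := hw c
    apply h
    -- At receiver `c` the example's `W` serves as the matrix of cell `c` and `W'` as that of the
    -- other cell; the two receivers may use unrelated examples.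
    let y : σ ⊕ τ → F' := Sum.elim x fun t => if t.1 = c then W t.2.1 t.2.2 else W' t.2.1 t.2.2
    have h1 := congrArg (MvPolynomial.aeval y).toRingHom h0
    rw [map_det_alignMatrix, map_zero] at h1
    convert h1 using 2
    congr 1
    · funext k
      have hc : ∀ A : Matrix ι ι (MvPolynomial σ F),
          A.map (MvPolynomial.aeval x) = (A.map inc).map (MvPolynomial.aeval y).toRingHom := by
        intro A
        ext i j
        simp [inc, MvPolynomial.aeval_rename, y]
      rw [hc, hc]
    · ext p j
      simp [V, y]
    · have : c + 1 ≠ c := by fin_cases c <;> decide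
      ext p j
      simp [V, y, this]
  -- The polynomial ring is a domain and `F` is infinite, so one point over `F` makes both
  -- determinants nonzero. Its precoder part is frozen; its channel part witnesses that the
  -- remaining polynomial is nonzero.
  have hne : Q 0 * Q 1 ≠ 0 := mul_ne_zero (hQ 0) (hQ 1)
  obtain ⟨y, hy⟩ : ∃ y, MvPolynomial.eval y (Q 0 * Q 1) ≠ 0 := by
    by_contra! h
    exact hne (MvPolynomial.funext fun y => by rw [h, map_zero])
  let ρ : MvPolynomial (σ ⊕ τ) F →ₐ[F] MvPolynomial σ F :=
    MvPolynomial.aeval (Sum.elim MvPolynomial.X fun t => MvPolynomial.C (y (Sum.inr t)))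
  have hρ : ∀ x q, MvPolynomial.eval x (ρ q) =
      MvPolynomial.eval (Sum.elim x fun t => y (Sum.inr t)) q := by
    intro x q
    induction q using MvPolynomial.induction_on with
    | C a => simp
    | add p q hp hq => simp [hp, hq]
    | mul_X p i hp =>
      rw [map_mul, map_mul, map_mul, hp]
      rcases i with i | i <;> simp [ρ]
  refine ⟨fun c => Matrix.of fun p j => y (Sum.inr (c, p, j)), ρ (Q 0 * Q 1), ?_, ?_⟩
  · intro h0
    apply hy
    have := hρ (fun s => y (Sum.inl s)) (Q 0 * Q 1)
    rw [h0, map_zero] at this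
    rw [this]
    congr 2
    ext (s | s) <;> rfl
  · intro x hx c
    rw [hρ, map_mul] at hx
    have hc : MvPolynomial.eval (Sum.elim x fun t => y (Sum.inr t)) (Q c) ≠ 0 := by
      fin_cases c
      · exact left_ne_zero_of_mul hx
      · exact right_ne_zero_of_mul hx
    rw [map_det_alignMatrix] at hc
    convert hc using 3
    · funext k
      have hc : ∀ A : Matrix ι ι (MvPolynomial σ F), A.map (MvPolynomial.eval x) =
          (A.map inc).map (MvPolynomial.eval (Sum.elim x fun t => y (Sum.inr t))) := by
        intro A
        ext i j
        simp [inc, MvPolynomial.eval_rename]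
      rw [hc, hc]
    · ext p j
      simp [V]
    · ext p j
      simp [V]

/-! ### The complexified real form -/

/-- The block form `[A, -B; B, A]`, entry by entry; the real form of `A + i B` for real `A`, `B`. -/
def blockForm {R m n : Type*} [Neg R] (A B : Matrix m n R) : Matrix (m × Fin 2) (n × Fin 2) R :=
  Matrix.of fun p q => !![A p.1 q.1, -B p.1 q.1; B p.1 q.1, A p.1 q.1] p.2 q.2

open Kronecker in
-- The columns of `P` simultaneously diagonalize all forms `[A, -B; B, A]`, with diagonal blocks `A
-- + iB` and `A - iB`. For complex `A` and `B` these two blocks are arbitrary, so the channel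
-- behaves like one with `2 * L` subchannels.
theorem exists_det_alignMatrix_blockForm_ne_zero {M L : ℕ} [NeZero M] [NeZero L] {K : ℕ}
    (hK0 : 0 < K) (hK : K ≤ 2 * M ^ 2 * L) :
    ∃ (A B : Fin K → Fin L → Matrix (Fin M) (Fin M) ℂ)
      (W W' : Matrix (((Fin M × Fin L) × Fin 2) × Fin (K + 1)) ((Fin M × Fin L) × Fin 2) ℂ),
      (alignMatrix (fun k => blockForm (Matrix.blockDiagonal (A k)) (Matrix.blockDiagonal (B k)))
        W W').det ≠ 0 := by
  obtain ⟨a, W, W', h⟩ := exists_det_alignMatrix_ne_zero (M := M) (Λ := Fin L × Fin 2)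
    (Equiv.prodAssoc (Fin M) (Fin L) (Fin 2)) hK0 (by simp; nlinarith)
  let P : Matrix (Fin 2) (Fin 2) ℂ := !![1, 1; -Complex.I, Complex.I]
  let U : Matrix ((Fin M × Fin L) × Fin 2) ((Fin M × Fin L) × Fin 2) ℂ :=
    (1 : Matrix (Fin M × Fin L) (Fin M × Fin L) ℂ) ⊗ₖ P
  have hU : U.det ≠ 0 := by
    rw [Matrix.det_kronecker]
    simp only [Matrix.det_one, one_pow, one_mul]
    refine pow_ne_zero _ ?_
    rw [Matrix.det_fin_two_of]
    simp [← two_mul]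
  refine ⟨fun k l => (1 / 2 : ℂ) • (a k (l, 0) + a k (l, 1)),
    fun k l => (-Complex.I / 2) • (a k (l, 0) - a k (l, 1)),
    symbolExt (K + 1) U * W, symbolExt (K + 1) U * W', ?_⟩
  rw [alignMatrix_symbolExt_mul (B := fun k => blockMatrix (Equiv.prodAssoc _ _ _) (a k)),
    Matrix.det_mul, det_symbolExt]
  · exact mul_ne_zero (pow_ne_zero _ hU) h
  · intro k
    ext ⟨⟨m, l⟩, α⟩ ⟨⟨m', l'⟩, β⟩
    have h1 : ∀ X : Matrix ((Fin M × Fin L) × Fin 2) ((Fin M × Fin L) × Fin 2) ℂ, ∀ i j α β,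
        (X * U) (i, α) (j, β) = ∑ γ, X (i, α) (j, γ) * P γ β := by
      intro X i j α β
      rw [Matrix.mul_apply, Fintype.sum_prod_type, Finset.sum_eq_single j]
      · simp [U]
      · intro b _ hb
        simp [U, hb]
      · simp
    have h2 : ∀ X : Matrix ((Fin M × Fin L) × Fin 2) ((Fin M × Fin L) × Fin 2) ℂ, ∀ i j α β,
        (U * X) (i, α) (j, β) = ∑ γ, P α γ * X (i, γ) (j, β) := by
      intro X i j α β
      rw [Matrix.mul_apply, Fintype.sum_prod_type, Finset.sum_eq_single i]
      · simp [U]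
      · intro b _ hb
        simp [U, Ne.symm hb]
      · simp
    rw [h1, h2, Fin.sum_univ_two, Fin.sum_univ_two]
    simp only [blockForm, blockMatrix, Matrix.of_apply, Matrix.submatrix_apply,
      Equiv.prodAssoc_apply, Matrix.blockDiagonal_apply, Prod.mk.injEq]
    by_cases hl : l = l'
    · subst hl
      fin_cases α <;> fin_cases β <;> simp [P] <;> ring_nf <;> simp <;> ring
    · fin_cases α <;> fin_cases β <;> simp [P, hl]

end IMAC

/-! ### Upper bound on the number of streams -/

namespace IMAC

section Bounds

variable {𝕜 ι : Type*} [RCLike 𝕜] [Fintype ι]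

theorem mulVec_injective_of_rank_eq {n : ℕ} {A : Matrix (Fin n) (Fin n) 𝕜} (hA : A.rank = n) :
    Function.Injective A.mulVecLin := by
  rw [LinearMap.injective_iff_surjective, ← LinearMap.range_eq_top]
  refine Submodule.eq_top_of_finrank_eq ?_
  rw [Module.finrank_fin_fun]
  exact hA

variable {K : ℕ} {n : Fin K → ℕ} {U B : (k : Fin K) → Matrix ι (Fin (n k)) 𝕜}

/-- The composite of all precoded channels and all combiners is block diagonal, with square diagonal
blocks of full rank. -/
theorem stack_comp_injective (hrank : ∀ k, ((U k)ᴴ * B k).rank = n k)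
    (hzero : ∀ k k', k' ≠ k → (U k')ᴴ * B k = 0) :
    Function.Injective ((LinearMap.pi fun k => ((U k)ᴴ).mulVecLin) ∘ₗ
      ∑ k, (B k).mulVecLin ∘ₗ (LinearMap.proj k : ((k : Fin K) → Fin (n k) → 𝕜) →ₗ[𝕜] _)) := by
  rw [← LinearMap.ker_eq_bot, LinearMap.ker_eq_bot']
  intro y hy
  funext k
  refine mulVec_injective_of_rank_eq (hrank k) ?_
  have := congrFun hy k
  simp only [LinearMap.comp_apply, LinearMap.pi_apply, LinearMap.sum_apply, LinearMap.proj_apply,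
    map_sum, Matrix.mulVecLin_apply, Matrix.mulVec_mulVec, Pi.zero_apply] at this
  rw [Finset.sum_eq_single k] at this
  · simpa using this
  · intro b _ hb
    rw [hzero b k hb.symm, Matrix.zero_mulVec]
  · simp

theorem finrank_streams : Module.finrank 𝕜 ((k : Fin K) → Fin (n k) → 𝕜) = ∑ k, n k := by
  rw [Module.finrank_pi_fintype]
  simp

/-- The desired streams and the interference fit together into the received signal space. -/
theorem sum_add_finrank_le (hrank : ∀ k, ((U k)ᴴ * B k).rank = n k)
    (hzero : ∀ k k', k' ≠ k → (U k')ᴴ * B k = 0) (I : Submodule 𝕜 (ι → 𝕜))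
    (hI : ∀ x ∈ I, ∀ k, (U k)ᴴ *ᵥ x = 0) :
    ∑ k, n k + Module.finrank 𝕜 I ≤ Fintype.card ι := by
  have hinj := stack_comp_injective hrank hzero
  have hsurj := LinearMap.injective_iff_surjective.1 hinj
  rw [LinearMap.coe_comp] at hsurj
  replace hsurj := hsurj.of_comp
  have h1 := LinearMap.finrank_range_add_finrank_ker
    (LinearMap.pi fun k => ((U k)ᴴ).mulVecLin)
  rw [LinearMap.range_eq_top.2 hsurj, finrank_top, finrank_streams, Module.finrank_pi] at h1
  rw [← h1]
  refine Nat.add_le_add_left (Submodule.finrank_mono fun x hx => ?_) _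
  rw [LinearMap.mem_ker]
  funext k
  exact hI x hx k

/-- The desired streams are received in linearly independent directions. -/
theorem sum_le_finrank (hrank : ∀ k, ((U k)ᴴ * B k).rank = n k)
    (hzero : ∀ k k', k' ≠ k → (U k')ᴴ * B k = 0) (J : Submodule 𝕜 (ι → 𝕜))
    (hJ : ∀ k y, B k *ᵥ y ∈ J) : ∑ k, n k ≤ Module.finrank 𝕜 J := by
  have hinj := stack_comp_injective hrank hzero
  rw [LinearMap.coe_comp] at hinj
  replace hinj := hinj.of_comp
  rw [← finrank_streams (𝕜 := 𝕜), ← LinearMap.finrank_range_of_inj hinj]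
  refine Submodule.finrank_mono ?_
  rintro _ ⟨y, rfl⟩
  rw [LinearMap.sum_apply]
  exact Submodule.sum_mem _ fun k _ => hJ k (y k)

/-- The space spanned by the images of a subspace `I` under the symbol extensions of a linear
family of matrices. -/
def familyImage {E : Type*} [AddCommGroup E] [Module 𝕜 E] (φ : E →ₗ[𝕜] Matrix ι ι 𝕜) (T : ℕ)
    (I : Submodule 𝕜 (ι × Fin T → 𝕜)) : Submodule 𝕜 (ι × Fin T → 𝕜) :=
  LinearMap.range (TensorProduct.lift (LinearMap.mk₂ 𝕜 (fun (a : E) (x : I) =>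
    symbolExt T (φ a) *ᵥ (x : ι × Fin T → 𝕜))
    (fun a b x => by rw [map_add, symbolExt_add, Matrix.add_mulVec])
    (fun s a x => by rw [map_smul, symbolExt_smul, Matrix.smul_mulVec])
    (fun a x y => by simp [Matrix.mulVec_add])
    (fun s a x => by simp [Matrix.mulVec_smul])))

theorem finrank_familyImage_le {E : Type*} [AddCommGroup E] [Module 𝕜 E] [FiniteDimensional 𝕜 E]
    (φ : E →ₗ[𝕜] Matrix ι ι 𝕜) (T : ℕ) (I : Submodule 𝕜 (ι × Fin T → 𝕜)) :
    Module.finrank 𝕜 (familyImage φ T I) ≤ Module.finrank 𝕜 E * Module.finrank 𝕜 I := by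
  rw [← Module.finrank_tensorProduct]
  exact LinearMap.finrank_range_le _

theorem mulVec_mem_familyImage {E : Type*} [AddCommGroup E] [Module 𝕜 E]
    (φ : E →ₗ[𝕜] Matrix ι ι 𝕜) (T : ℕ) {I : Submodule 𝕜 (ι × Fin T → 𝕜)} (a : E)
    {x : ι × Fin T → 𝕜} (hx : x ∈ I) : symbolExt T (φ a) *ᵥ x ∈ familyImage φ T I :=
  ⟨a ⊗ₜ ⟨x, hx⟩, by simp⟩

variable [DecidableEq ι] {G : Fin 2 → Fin 2 → Fin K → Matrix ι ι 𝕜} {T : ℕ}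

/-- The span of the interference that cell `c` causes at receiver `r`. -/
def interference (T : ℕ) (G : Fin 2 → Fin 2 → Fin K → Matrix ι ι 𝕜) {n : Fin 2 → Fin K → ℕ}
    (V : (c : Fin 2) → (k : Fin K) → Matrix (ι × Fin T) (Fin (n c k)) 𝕜) (r c : Fin 2) :
    Submodule 𝕜 (ι × Fin T → 𝕜) :=
  ⨆ k, LinearMap.range (symbolExt T (G r c k) * V c k).mulVecLin

/-- For the bound by `K`, an invertible cross channel preserves the rank of each precoder. For the
bound by `finrank E`, the quotients `φ a` carry the interference back to the desired signals, which
are independent and thus fit into `familyImage`. -/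
theorem sum_le_min_mul_finrank_interference {E : Type*} [AddCommGroup E] [Module 𝕜 E]
    [FiniteDimensional 𝕜 E] (φ : E →ₗ[𝕜] Matrix ι ι 𝕜) {n : Fin 2 → Fin K → ℕ}
    {V U : (c : Fin 2) → (k : Fin K) → Matrix (ι × Fin T) (Fin (n c k)) 𝕜} {r c : Fin 2}
    (hG : ∀ k, IsUnit (G r c k).det) (hφ : ∀ k, ∃ a, G c c k = φ a * G r c k)
    (hrank : ∀ k, ((U c k)ᴴ * symbolExt T (G c c k) * V c k).rank = n c k)
    (hzero : ∀ k k', k' ≠ k → (U c k')ᴴ * symbolExt T (G c c k) * V c k = 0) :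
    ∑ k, n c k ≤
      min K (Module.finrank 𝕜 E) * Module.finrank 𝕜 (interference T G V r c) := by
  have hmem : ∀ k y, (symbolExt T (G r c k) * V c k) *ᵥ y ∈ interference T G V r c := fun k y =>
    Submodule.mem_iSup_of_mem k ⟨y, rfl⟩
  rcases min_choice K (Module.finrank 𝕜 E) with hmin | hmin <;> rw [hmin]
  · have : ∀ k, n c k ≤ Module.finrank 𝕜 (interference T G V r c) := by
      intro k
      have hu : IsUnit (symbolExt T (G r c k)).det := by
        rw [det_symbolExt]
        exact (hG k).pow T
      calc n c k = _ := (hrank k).symm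
        _ ≤ (V c k).rank := Matrix.rank_mul_le_right _ _
        _ = (symbolExt T (G r c k) * V c k).rank :=
            (Matrix.rank_mul_eq_right_of_isUnit_det _ _ hu).symm
        _ ≤ _ := Submodule.finrank_mono (le_iSup
            (fun k => LinearMap.range (symbolExt T (G r c k) * V c k).mulVecLin) k)
    calc ∑ k, n c k ≤ ∑ _k : Fin K, _ := Finset.sum_le_sum fun k _ => this k
      _ = _ := by simp
  · refine le_trans ?_ (finrank_familyImage_le φ T _)
    refine sum_le_finrank (U := U c) (B := fun k => symbolExt T (G c c k) * V c k) ?_ ?_ _ ?_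
    · simpa only [Matrix.mul_assoc] using hrank
    · simpa only [Matrix.mul_assoc] using hzero
    · intro k y
      obtain ⟨a, ha⟩ := hφ k
      rw [ha, symbolExt_mul, Matrix.mul_assoc, ← Matrix.mulVec_mulVec]
      exact mulVec_mem_familyImage φ T a (hmem k y)

/-- Upper bound on the number of streams. `φ` parametrizes a space of matrices that contains the
quotients of the direct and the cross channels. -/
theorem IAFeasible.sum_le {E : Type*} [AddCommGroup E] [Module 𝕜 E] [FiniteDimensional 𝕜 E]
    (φ : E →ₗ[𝕜] Matrix ι ι 𝕜) {n : Fin 2 → Fin K → ℕ}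
    (hG : ∀ r c k, IsUnit (G r c k).det) (hφ : ∀ r c k, ∃ a, G c c k = φ a * G r c k)
    (h : IAFeasible (fun r c k => symbolExt T (G r c k)) n) :
    (min K (Module.finrank 𝕜 E) + 1) * ∑ c, ∑ k, n c k ≤
      2 * min K (Module.finrank 𝕜 E) * (Fintype.card ι * T) := by
  obtain ⟨V, U, hrank, hzero⟩ := h
  have h1 : ∀ r c, ∑ k, n c k ≤
      min K (Module.finrank 𝕜 E) * Module.finrank 𝕜 (interference T G V r c) := fun r c =>
    sum_le_min_mul_finrank_interference φ (hG r c) (hφ r c) (hrank c)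
      fun k k' hk => hzero c k c k' (by simpa using hk)
  have h2 : ∀ r c, r ≠ c → ∑ k, n r k + Module.finrank 𝕜 (interference T G V r c) ≤
      Fintype.card ι * T := by
    intro r c hrc
    have := sum_add_finrank_le (U := U r) (B := fun k => symbolExt T (G r r k) * V r k)
      (by simpa only [Matrix.mul_assoc] using hrank r)
      (fun k k' hk => by
        simpa only [Matrix.mul_assoc] using hzero r k r k' (by simpa using hk))
      (interference T G V r c) (fun x hx k => ?_)
    · simpa using this
    · have : interference T G V r c ≤ LinearMap.ker ((U r k)ᴴ).mulVecLin := by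
        refine iSup_le fun k' => ?_
        rintro _ ⟨y, rfl⟩
        rw [LinearMap.mem_ker, Matrix.mulVecLin_apply, Matrix.mulVecLin_apply,
          Matrix.mulVec_mulVec, ← Matrix.mul_assoc, hzero c k' r k (by simp [hrc]),
          Matrix.zero_mulVec]
      exact this hx
  have a1 := h1 1 0
  have a2 := h1 0 1
  have b1 := h2 0 1 (by decide)
  have b2 := h2 1 0 (by decide)
  rw [Fin.sum_univ_two]
  set m := min K (Module.finrank 𝕜 E)
  -- For each cell `r`, with `c` the other one, `m * S_r + S_c ≤ m * card ι * T`; the claim is the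
  -- sum of the two inequalities.
  nlinarith [Nat.mul_le_mul_left m b1, Nat.mul_le_mul_left m b2]

end Bounds

/-! ### Attainment by aligned precoders -/

/-- If the received signals with aligned interference have full rank at both receivers, then every
one of the first `κ` users in both cells can send `card ι` streams. -/
theorem iaFeasible_of_det_ne_zero {𝕜 ι : Type*} [RCLike 𝕜] [Fintype ι] [DecidableEq ι] {K κ : ℕ}
    (hκ : κ ≤ K) (G : Fin 2 → Fin 2 → Fin K → Matrix ι ι 𝕜)
    (w : Fin 2 → Matrix (ι × Fin (κ + 1)) ι 𝕜)
    (hdet : ∀ c, (alignMatrix (fun k : Fin κ => G c c (Fin.castLE hκ k) *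
      (G (c + 1) c (Fin.castLE hκ k)).adjugate) (w c) (w (c + 1))).det ≠ 0) :
    IAFeasible (fun r c k => symbolExt (κ + 1) (G r c k))
      (fun _ k => if (k : ℕ) < κ then Fintype.card ι else 0) := by
  classical
  let B := fun c => alignMatrix (fun k : Fin κ => G c c (Fin.castLE hκ k) *
    (G (c + 1) c (Fin.castLE hκ k)).adjugate) (w c) (w (c + 1))
  have hB : ∀ c, (B c)⁻¹ * B c = 1 := fun c => Matrix.nonsing_inv_mul _ (hdet c).isUnit
  -- `f k` enumerates `ι` by the streams of an active user and has empty domain for a silent one.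
  have hf : ∀ k : Fin K, ∃ f : Fin (if (k : ℕ) < κ then Fintype.card ι else 0) → ι,
      Function.Injective f := by
    intro k
    obtain ⟨f⟩ := Function.Embedding.nonempty_of_card_le
      (α := Fin (if (k : ℕ) < κ then Fintype.card ι else 0)) (β := ι) (by
        rw [Fintype.card_fin]
        split_ifs <;> omega)
    exact ⟨f, f.injective⟩
  have hcell : ∀ c c' : Fin 2, c ≠ c' → c = c' + 1 := by decide
  choose f hf using hf
  have hlt : ∀ k : Fin K, Fin (if (k : ℕ) < κ then Fintype.card ι else 0) → (k : ℕ) < κ := by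
    intro k i
    by_contra h
    rw [if_neg h] at i
    exact i.elim0
  -- The adjugate cancels the cross channel up to its determinant, so every user of cell `c` is
  -- heard at the other receiver within the columns of `w c`.
  let V0 : Fin 2 → Fin K → Matrix (ι × Fin (κ + 1)) ι 𝕜 := fun c k =>
    symbolExt (κ + 1) (G (c + 1) c k).adjugate * w c
  -- Zero forcing: the rows of the inverse received matrix that belong to user `k`. Block `0`
  -- belongs to the interference, hence the `succ`.
  let R0 : Fin 2 → Fin K → Matrix ι (ι × Fin (κ + 1)) 𝕜 := fun c k =>
    if h : (k : ℕ) < κ then Matrix.of fun j p => (B c)⁻¹ (j, (⟨k, h⟩ : Fin κ).succ) p else 0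
  have hR0 : ∀ c (k : Fin K) (h : (k : ℕ) < κ) (α : Type _) (A : Matrix (ι × Fin (κ + 1)) α 𝕜) i j,
      (R0 c k * A) i j = ((B c)⁻¹ * A) (i, (⟨k, h⟩ : Fin κ).succ) j := by
    intro c k h α A i j
    simp [R0, h, Matrix.mul_apply]
  have hdirect : ∀ c (k k' : Fin K) (h : (k : ℕ) < κ) (h' : (k' : ℕ) < κ) i j,
      (R0 c k * symbolExt (κ + 1) (G c c k') * V0 c k') i j =
        (1 : Matrix (ι × Fin (κ + 1)) (ι × Fin (κ + 1)) 𝕜)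
          (i, (⟨k, h⟩ : Fin κ).succ) (j, (⟨k', h'⟩ : Fin κ).succ) := by
    intro c k k' h h' i j
    rw [Matrix.mul_assoc, hR0 c k h, ← hB c]
    simp only [V0, ← Matrix.mul_assoc, ← symbolExt_mul]
    rw [Matrix.mul_assoc, Matrix.mul_apply, Matrix.mul_apply]
    rfl
  have hcross : ∀ c (k k' : Fin K) (_ : (k : ℕ) < κ) i j,
      (R0 c k * symbolExt (κ + 1) (G c (c + 1) k') * V0 (c + 1) k') i j = 0 := by
    intro c k k' h i j
    have hc : c + 1 + 1 = c := by fin_cases c <;> rfl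
    have hs : symbolExt (κ + 1) (G c (c + 1) k') * V0 (c + 1) k' =
        (G c (c + 1) k').det • w (c + 1) := by
      simp only [V0, ← Matrix.mul_assoc, ← symbolExt_mul, hc, Matrix.mul_adjugate]
      rw [symbolExt_smul, symbolExt_one, Matrix.smul_mul, Matrix.one_mul]
    rw [Matrix.mul_assoc, hs, Matrix.mul_smul, Matrix.smul_apply, hR0 c k h]
    have : ((B c)⁻¹ * w (c + 1)) (i, (⟨k, h⟩ : Fin κ).succ) j =
        ((B c)⁻¹ * B c) (i, (⟨k, h⟩ : Fin κ).succ) (j, 0) := by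
      rw [Matrix.mul_apply, Matrix.mul_apply]
      rfl
    rw [this, hB, Matrix.one_apply_ne (by simp), smul_zero]
  have hentry : ∀ c c' k k' (A : Matrix (ι × Fin (κ + 1)) (ι × Fin (κ + 1)) 𝕜),
      ((R0 c k)ᴴ.submatrix id (f k))ᴴ * A * (V0 c' k').submatrix id (f k') =
        (R0 c k * A * V0 c' k').submatrix (f k) (f k') := by
    intro c c' k k' A
    rw [Matrix.conjTranspose_submatrix, Matrix.conjTranspose_conjTranspose]
    rfl
  refine ⟨fun c k => (V0 c k).submatrix id (f k), fun c k => (R0 c k)ᴴ.submatrix id (f k),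
    fun c k => ?_, fun c k c' k' hne => ?_⟩
  · rw [hentry]
    have : (R0 c k * symbolExt (κ + 1) (G c c k) * V0 c k).submatrix (f k) (f k) = 1 := by
      ext i j
      rw [Matrix.submatrix_apply, hdirect c k k (hlt k i) (hlt k i)]
      simp [Matrix.one_apply, (hf k).eq_iff]
    rw [this, Matrix.rank_one, Fintype.card_fin]
  · rw [hentry]
    ext i j
    rw [Matrix.submatrix_apply, Matrix.zero_apply]
    by_cases hc : c = c'
    · subst hc
      rw [hdirect c k' k (hlt k' i) (hlt k j)]
      refine Matrix.one_apply_ne ?_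
      have : k' ≠ k := fun h => hne (by rw [h])
      simpa [Fin.ext_iff] using fun _ => this
    · obtain rfl := hcell c c' hc
      exact hcross c' k' k (hlt k' i) _ _

end IMAC

/-! ### The optimum for a fixed channel realization -/

namespace IMAC

theorem sum_ite_lt {K κ N : ℕ} (hκ : κ ≤ K) :
    ∑ _c : Fin 2, ∑ k : Fin K, (((if (k : ℕ) < κ then N else 0 : ℕ)) : ℝ) = 2 * κ * N := by
  have : ∑ k : Fin K, (((if (k : ℕ) < κ then N else 0 : ℕ)) : ℝ) = κ * N := by
    rw [Fin.sum_univ_eq_sum_range (fun k => (((if k < κ then N else 0 : ℕ)) : ℝ)) K,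
      ← Finset.sum_subset (Finset.range_mono hκ)]
    · rw [Finset.sum_congr rfl fun k hk => by rw [if_pos (Finset.mem_range.1 hk)]]
      simp
    · intro k _ hk
      rw [if_neg (by simpa using hk), Nat.cast_zero]
  rw [Fin.sum_univ_two, this]
  ring

/-- The largest normalized number of streams, under the conditions that hold almost surely. -/
theorem isGreatest_of_aligned {𝕜 ι E : Type*} [RCLike 𝕜] [Fintype ι] [DecidableEq ι]
    [AddCommGroup E] [Module 𝕜 E] [FiniteDimensional 𝕜 E] {K κ : ℕ}
    (hκ : κ = min K (Module.finrank 𝕜 E)) (hκK : κ ≤ K)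
    (φ : E →ₗ[𝕜] Matrix ι ι 𝕜) (G : Fin 2 → Fin 2 → Fin K → Matrix ι ι 𝕜)
    (hG : ∀ r c k, IsUnit (G r c k).det) (hφ : ∀ r c k, ∃ a, G c c k = φ a * G r c k)
    (w : Fin 2 → Matrix (ι × Fin (κ + 1)) ι 𝕜)
    (hdet : ∀ c, (alignMatrix (fun k : Fin κ => G c c (Fin.castLE hκK k) *
      (G (c + 1) c (Fin.castLE hκK k)).adjugate) (w c) (w (c + 1))).det ≠ 0) {s : ℝ} (hs : 0 < s) :
    IsGreatest {d : ℝ | ∃ T : ℕ, 0 < T ∧ ∃ n : Fin 2 → Fin K → ℕ,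
        IAFeasible (fun r c k => symbolExt T (G r c k)) n ∧
        d = 1 / (s * (T : ℝ)) * ∑ c : Fin 2, ∑ k : Fin K, (n c k : ℝ)}
      (2 * κ * Fintype.card ι / (s * (κ + 1))) := by
  refine ⟨⟨κ + 1, κ.succ_pos, _, iaFeasible_of_det_ne_zero hκK G w hdet, ?_⟩, ?_⟩
  · rw [sum_ite_lt hκK]
    push_cast
    ring
  · rintro _ ⟨T, hT, n, hn, rfl⟩
    have h := IAFeasible.sum_le φ hG hφ hn
    rw [← hκ] at h
    have h' : ((κ : ℝ) + 1) * ∑ c : Fin 2, ∑ k : Fin K, (n c k : ℝ) ≤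
        2 * κ * (Fintype.card ι * T) := by exact_mod_cast h
    have hT' : (0 : ℝ) < T := by exact_mod_cast hT
    rw [one_div_mul_eq_div, div_le_div_iff₀ (by positivity) (by positivity)]
    nlinarith [mul_le_mul_of_nonneg_left h' hs.le]

/-! ### Real forms and spaces of block-diagonal matrices -/

section RealForm

variable {m : Type*}

theorem realForm_mul [Fintype m] (A B : Matrix m m ℂ) :
    realForm (A * B) = realForm A * realForm B := by
  ext ⟨i, α⟩ ⟨j, β⟩
  rw [Matrix.mul_apply, Fintype.sum_prod_type]
  fin_cases α <;> fin_cases β <;>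
    simp [realForm, Matrix.mul_apply, Fin.sum_univ_two, Complex.re_sum, Complex.im_sum,
      Finset.sum_add_distrib, ← Finset.sum_neg_distrib, sub_eq_add_neg, add_comm]

theorem realForm_one [DecidableEq m] : realForm (1 : Matrix m m ℂ) = 1 := by
  ext ⟨i, α⟩ ⟨j, β⟩
  by_cases h : i = j
  · subst h
    fin_cases α <;> fin_cases β <;> simp [realForm]
  · fin_cases α <;> fin_cases β <;> simp [realForm, h]

theorem isUnit_det_realForm [Fintype m] [DecidableEq m] {A : Matrix m m ℂ} (hA : IsUnit A.det) :
    IsUnit (realForm A).det := by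
  have h := congrArg realForm (Matrix.mul_nonsing_inv A hA)
  rw [realForm_mul, realForm_one] at h
  exact Matrix.isUnit_det_of_right_inverse h

end RealForm

/-- The linear map that assembles a block diagonal matrix from its blocks. -/
def blockDiagonalLinear (M L : ℕ) : (Fin L → Matrix (Fin M) (Fin M) ℂ) →ₗ[ℂ]
    Matrix (Fin M × Fin L) (Fin M × Fin L) ℂ where
  toFun := Matrix.blockDiagonal
  map_add' := Matrix.blockDiagonal_add
  map_smul' := Matrix.blockDiagonal_smul

/-- The real linear map that assembles the real form of a block diagonal matrix from its blocks. -/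
def realBlockDiagonalLinear (M L : ℕ) : (Fin L → Matrix (Fin M) (Fin M) ℂ) →ₗ[ℝ]
    Matrix ((Fin M × Fin L) × Fin 2) ((Fin M × Fin L) × Fin 2) ℝ where
  toFun X := realForm (Matrix.blockDiagonal X)
  map_add' X Y := by
    ext ⟨i, α⟩ ⟨j, β⟩
    rw [Matrix.blockDiagonal_add]
    fin_cases α <;> fin_cases β <;> simp [realForm, add_comm]
  map_smul' s X := by
    ext ⟨i, α⟩ ⟨j, β⟩
    rw [Matrix.blockDiagonal_smul]
    fin_cases α <;> fin_cases β <;> simp [realForm]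

theorem finrank_blocks (M L : ℕ) :
    Module.finrank ℂ (Fin L → Matrix (Fin M) (Fin M) ℂ) = M ^ 2 * L := by
  rw [Module.finrank_pi_fintype]
  simp [Module.finrank_matrix]
  ring

theorem finrank_real_blocks (M L : ℕ) :
    Module.finrank ℝ (Fin L → Matrix (Fin M) (Fin M) ℂ) = 2 * M ^ 2 * L := by
  rw [finrank_real_of_complex, finrank_blocks, mul_assoc]

/-! ### Algebraic genericity of the channel -/

section Channel

variable {K M L : ℕ}

theorem joint_isUnit_det {H : Channel K M L} (hH : ∀ r c k l, (H r c k l).det ≠ 0) (r c k) :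
    IsUnit (H.joint r c k).det := by
  rw [Channel.joint, Matrix.det_blockDiagonal, isUnit_iff_ne_zero]
  exact Finset.prod_ne_zero_iff.2 fun l _ => hH r c k l

/-- Quotients of block-diagonal matrices are again block diagonal. This confinement to a space of
small dimension is what limits the benefit of additional users. -/
theorem exists_joint_eq {H : Channel K M L} (hH : ∀ r c k l, (H r c k l).det ≠ 0) (r c k) :
    ∃ a : Fin L → Matrix (Fin M) (Fin M) ℂ,
      H.joint c c k = Matrix.blockDiagonal a * H.joint r c k := by
  refine ⟨fun l => H c c k l * (H r c k l)⁻¹, ?_⟩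
  rw [Channel.joint, Channel.joint, ← Matrix.blockDiagonal_mul]
  congr 1
  funext l
  rw [Matrix.mul_assoc, Matrix.nonsing_inv_mul _ (hH r c k l).isUnit, Matrix.mul_one]

/-- The joint channel matrix with indeterminate coefficients. -/
noncomputable def polyJoint {R : Type*} [CommRing R] (r c : Fin 2) (k : Fin K) :
    Matrix (Fin M × Fin L) (Fin M × Fin L) (MvPolynomial (CoeffIndex K M L) R) :=
  Matrix.blockDiagonal fun l => Matrix.of fun i j => MvPolynomial.X (r, c, k, l, i, j)

/-- The real form of the joint channel matrix with indeterminate real and imaginary parts of the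
coefficients. -/
noncomputable def polyRealJoint {R : Type*} [CommRing R] (r c : Fin 2) (k : Fin K) :
    Matrix ((Fin M × Fin L) × Fin 2) ((Fin M × Fin L) × Fin 2)
      (MvPolynomial (CoeffIndex K M L × Fin 2) R) :=
  blockForm
    (Matrix.blockDiagonal fun l => Matrix.of fun i j => MvPolynomial.X ((r, c, k, l, i, j), 0))
    (Matrix.blockDiagonal fun l => Matrix.of fun i j => MvPolynomial.X ((r, c, k, l, i, j), 1))

/-- The witness has identity cross channels and takes its direct channels from the explicit scheme.
Users beyond the first `κ` do not enter the determinant, so their direct channels are set to zero.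
-/
theorem exists_generic_precoders_css [NeZero M] [NeZero L] {κ : ℕ} (hκ : κ ≤ K) (hκ0 : 0 < κ)
    (hκD : κ ≤ M ^ 2 * L) :
    ∃ (w : Fin 2 → Matrix ((Fin M × Fin L) × Fin (κ + 1)) (Fin M × Fin L) ℂ)
      (p : MvPolynomial (CoeffIndex K M L) ℂ), p ≠ 0 ∧
      ∀ x, MvPolynomial.eval x p ≠ 0 → ∀ c,
        (alignMatrix (fun k : Fin κ => (Channel.ofCoeffs x).joint c c (Fin.castLE hκ k) *
          ((Channel.ofCoeffs x).joint (c + 1) c (Fin.castLE hκ k)).adjugate)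
          (w c) (w (c + 1))).det ≠ 0 := by
  obtain ⟨a, W, W', h⟩ := exists_det_alignMatrix_ne_zero (M := M) (Λ := Fin L)
    (Equiv.refl (Fin M × Fin L)) hκ0 (by simp; nlinarith)
  have hmap : ∀ (x : CoeffIndex K M L → ℂ) r c k,
      (polyJoint (R := ℂ) r c k).map (MvPolynomial.aeval x) =
        (Channel.ofCoeffs x).joint r c k := by
    intro x r c k
    ext i j
    simp only [polyJoint, Channel.joint, Channel.ofCoeffs, Matrix.blockDiagonal_apply,
      Matrix.map_apply]
    split_ifs <;> simp
  obtain ⟨w, p, hp, hw⟩ := exists_generic_precoders (F := ℂ) (F' := ℂ)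
    (fun c (k : Fin κ) => polyJoint (K := K) (M := M) (L := L) c c (Fin.castLE hκ k))
    (fun c k => polyJoint (c + 1) c (Fin.castLE hκ k)) (fun c => by
      let x : CoeffIndex K M L → ℂ := fun y =>
        if y.1 = y.2.1 then
          if hk : (y.2.2.1 : ℕ) < κ then a ⟨y.2.2.1, hk⟩ y.2.2.2.1 y.2.2.2.2.1 y.2.2.2.2.2 else 0
        else (1 : Matrix (Fin M) (Fin M) ℂ) y.2.2.2.2.1 y.2.2.2.2.2
      refine ⟨x, W, W', (congrArg (fun A => (alignMatrix A W W').det ≠ 0)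
        (funext fun k => ?_)).mpr h⟩
      have h1 : (Channel.ofCoeffs x).joint c c (Fin.castLE hκ k) =
          blockMatrix (Equiv.refl (Fin M × Fin L)) (a k) := by
        ext i j
        simp [Channel.joint, Channel.ofCoeffs, blockMatrix, Matrix.blockDiagonal_apply, x]
      have h2 : (Channel.ofCoeffs x).joint (c + 1) c (Fin.castLE hκ k) = 1 := by
        rw [Channel.joint, ← Matrix.blockDiagonal_one]
        congr 1
        funext l
        ext i j
        have := (by decide : ∀ c : Fin 2, c + 1 ≠ c) c
        simp [Channel.ofCoeffs, x, this]
      rw [hmap, hmap, h1, h2, Matrix.adjugate_one, Matrix.mul_one])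
  refine ⟨w, p, hp, fun x hx c => ?_⟩
  have := hw x hx c
  refine (congrArg (fun A => (alignMatrix A (w c) (w (c + 1))).det ≠ 0)
    (funext fun k => ?_)).mp this
  rw [← hmap, ← hmap]
  rfl

/-- The determinant is a real polynomial in real and imaginary parts, and its being nonzero is
tested at a complex point, where the real form splits. The resulting precoders are nevertheless
real. -/
theorem exists_generic_precoders_acs [NeZero M] [NeZero L] {κ : ℕ} (hκ : κ ≤ K) (hκ0 : 0 < κ)
    (hκD : κ ≤ 2 * M ^ 2 * L) :
    ∃ (w : Fin 2 → Matrix (((Fin M × Fin L) × Fin 2) × Fin (κ + 1)) ((Fin M × Fin L) × Fin 2) ℝ)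
      (p : MvPolynomial (CoeffIndex K M L × Fin 2) ℝ), p ≠ 0 ∧
      ∀ x : CoeffIndex K M L → ℂ,
        MvPolynomial.eval (fun y => ![(x y.1).re, (x y.1).im] y.2) p ≠ 0 → ∀ c,
        (alignMatrix (fun k : Fin κ =>
          realForm ((Channel.ofCoeffs x).joint c c (Fin.castLE hκ k)) *
          (realForm ((Channel.ofCoeffs x).joint (c + 1) c (Fin.castLE hκ k))).adjugate)
          (w c) (w (c + 1))).det ≠ 0 := by
  obtain ⟨A, B, W, W', h⟩ := exists_det_alignMatrix_blockForm_ne_zero (M := M) (L := L) hκ0 hκD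
  have hmap : ∀ (x : CoeffIndex K M L → ℂ) r c k,
      (polyRealJoint (R := ℝ) r c k).map
        (MvPolynomial.eval (fun y => ![(x y.1).re, (x y.1).im] y.2)) =
        realForm ((Channel.ofCoeffs x).joint r c k) := by
    intro x r c k
    ext ⟨i, α⟩ ⟨j, β⟩
    fin_cases α <;> fin_cases β <;>
    simp [polyRealJoint, blockForm, realForm, Channel.joint, Channel.ofCoeffs,
      Matrix.blockDiagonal_apply] <;> split_ifs <;> simp
  have hmap' : ∀ (x : CoeffIndex K M L × Fin 2 → ℂ) r c k,
      (polyRealJoint (R := ℝ) r c k).map (MvPolynomial.aeval x) = blockForm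
        (Matrix.blockDiagonal fun l => Matrix.of fun i j => x ((r, c, k, l, i, j), 0))
        (Matrix.blockDiagonal fun l => Matrix.of fun i j => x ((r, c, k, l, i, j), 1)) := by
    intro x r c k
    ext ⟨i, α⟩ ⟨j, β⟩
    fin_cases α <;> fin_cases β <;>
    simp [polyRealJoint, blockForm, Matrix.blockDiagonal_apply] <;> split_ifs <;> simp
  obtain ⟨w, p, hp, hw⟩ := exists_generic_precoders (F := ℝ) (F' := ℂ)
    (fun c (k : Fin κ) => polyRealJoint (K := K) (M := M) (L := L) c c (Fin.castLE hκ k))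
    (fun c k => polyRealJoint (c + 1) c (Fin.castLE hκ k)) (fun c => by
      let x : CoeffIndex K M L × Fin 2 → ℂ := fun y =>
        if y.1.1 = y.1.2.1 then
          if hk : (y.1.2.2.1 : ℕ) < κ then
            ![A, B] y.2 ⟨y.1.2.2.1, hk⟩ y.1.2.2.2.1 y.1.2.2.2.2.1 y.1.2.2.2.2.2 else 0
        else ![1, (0 : Matrix (Fin M) (Fin M) ℂ)] y.2 y.1.2.2.2.2.1 y.1.2.2.2.2.2
      refine ⟨x, W, W', (congrArg (fun A => (alignMatrix A W W').det ≠ 0)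
        (funext fun k => ?_)).mpr h⟩
      have h1 : ∀ l, (Matrix.of fun i j => x ((c, c, Fin.castLE hκ k, l, i, j), 0)) = A k l := by
        intro l
        ext i j
        simp [x]
      have h2 : ∀ l, (Matrix.of fun i j => x ((c, c, Fin.castLE hκ k, l, i, j), 1)) = B k l := by
        intro l
        ext i j
        simp [x]
      have hc := (by decide : ∀ c : Fin 2, c + 1 ≠ c) c
      have h3 : ∀ l, (Matrix.of fun i j => x ((c + 1, c, Fin.castLE hκ k, l, i, j), 0)) = 1 := by
        intro l
        ext i j
        simp [x, hc]
      have h4 : ∀ l, (Matrix.of fun i j => x ((c + 1, c, Fin.castLE hκ k, l, i, j), 1)) = 0 := by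
        intro l
        ext i j
        simp [x, hc]
      have h5 : blockForm (1 : Matrix (Fin M × Fin L) (Fin M × Fin L) ℂ) 0 = 1 := by
        ext ⟨i, α⟩ ⟨j, β⟩
        by_cases h : i = j
        · subst h
          fin_cases α <;> fin_cases β <;> simp [blockForm]
        · fin_cases α <;> fin_cases β <;> simp [blockForm, h]
      rw [hmap', hmap']
      simp only [h1, h2, h3, h4]
      have h6 : (Matrix.blockDiagonal fun _ : Fin L => (1 : Matrix (Fin M) (Fin M) ℂ)) = 1 :=
        Matrix.blockDiagonal_one
      have h7 : (Matrix.blockDiagonal fun _ : Fin L => (0 : Matrix (Fin M) (Fin M) ℂ)) = 0 :=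
        Matrix.blockDiagonal_zero
      rw [h6, h7, h5, Matrix.adjugate_one, Matrix.mul_one])
  refine ⟨w, p, hp, fun x hx c => ?_⟩
  have := hw _ hx c
  refine (congrArg (fun A => (alignMatrix A (w c) (w (c + 1))).det ≠ 0)
    (funext fun k => ?_)).mp this
  rw [← hmap, ← hmap]

end Channel

/-! ### From generic to almost sure -/

section Random

variable {Ω : Type*} [MeasurableSpace Ω] {P : Measure Ω} [IsProbabilityMeasure P] {ι : Type*}
  [Fintype ι] {h : ι → Ω → ℂ} {ν : Measure ℂ}

theorem ae_of_ae_pi_law (h_meas : ∀ x, Measurable (h x)) (h_indep : iIndepFun h P)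
    (h_law : ∀ x, P.map (h x) = ν) {Q : (ι → ℂ) → Prop}
    (hQ : ∀ᵐ z ∂Measure.pi fun _ : ι => ν, Q z) : ∀ᵐ ω ∂P, Q fun x => h x ω := by
  have hmap := (iIndepFun_iff_map_fun_eq_pi_map fun x => (h_meas x).aemeasurable).1 h_indep
  simp only [h_law] at hmap
  rw [← hmap] at hQ
  exact ae_of_ae_map (measurable_pi_lambda _ h_meas).aemeasurable hQ

theorem ae_eval_ne_zero [SigmaFinite ν] (h_meas : ∀ x, Measurable (h x)) (h_indep : iIndepFun h P)
    (h_law : ∀ x, P.map (h x) = ν) (h_cont : ν ≪ (volume : Measure ℂ))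
    (p : MvPolynomial ι ℂ) (hp : p ≠ 0) :
    ∀ᵐ ω ∂P, MvPolynomial.eval (fun x => h x ω) p ≠ 0 := by
  have hp' : MvPolynomial.rename (fun x => (x, ())) p ≠ 0 := fun h0 =>
    hp (MvPolynomial.rename_injective (fun x : ι => (x, ())) (fun a b h => by simpa using h)
      (by simpa using h0))
  have := ae_pi_eval_ne_zero (μ := ν) (φ := fun x (_ : Unit) => x) (by fun_prop)
    (fun q hq => h_cont.ae_le (ae_eval_ne_zero_of_nullSingletonClass q hq)) _ hp'
  refine ae_of_ae_pi_law h_meas h_indep h_law (Q := fun z => MvPolynomial.eval z p ≠ 0)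
    (this.mono fun z hz => ?_)
  rwa [MvPolynomial.eval_rename] at hz

theorem ae_eval_reim_family_ne_zero [SigmaFinite ν] (h_meas : ∀ x, Measurable (h x))
    (h_indep : iIndepFun h P) (h_law : ∀ x, P.map (h x) = ν) (h_cont : ν ≪ (volume : Measure ℂ))
    (p : MvPolynomial (ι × Fin 2) ℝ) (hp : p ≠ 0) :
    ∀ᵐ ω ∂P, MvPolynomial.eval (fun y => ![(h y.1 ω).re, (h y.1 ω).im] y.2) p ≠ 0 := by
  have hm : Measurable fun z : ℂ => ![z.re, z.im] := by
    refine measurable_pi_lambda _ fun i => ?_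
    fin_cases i
    · exact Complex.measurable_re
    · exact Complex.measurable_im
  exact ae_of_ae_pi_law h_meas h_indep h_law
    (Q := fun z => MvPolynomial.eval (fun y => ![(z y.1).re, (z y.1).im] y.2) p ≠ 0) (ae_pi_eval_ne_zero (μ := ν) hm
    (fun q hq => h_cont.ae_le (ae_eval_reim_ne_zero q hq)) p hp)

theorem ae_det_ne_zero [SigmaFinite ν] {K M L : ℕ} {h : CoeffIndex K M L → Ω → ℂ}
    (h_meas : ∀ x, Measurable (h x)) (h_indep : iIndepFun h P)
    (h_law : ∀ x, P.map (h x) = ν) (h_cont : ν ≪ (volume : Measure ℂ)) :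
    ∀ᵐ ω ∂P, ∀ r c k l, (Channel.ofCoeffs (fun x => h x ω) r c k l).det ≠ 0 := by
  simp only [ae_all_iff]
  intro r c k l
  have hev : ∀ x : CoeffIndex K M L → ℂ, MvPolynomial.eval x (Matrix.det (Matrix.of fun i j =>
      (MvPolynomial.X (r, c, k, l, i, j) : MvPolynomial (CoeffIndex K M L) ℂ))) =
      (Channel.ofCoeffs x r c k l).det := by
    intro x
    rw [RingHom.map_det]
    congr 1
    ext i j
    simp [Channel.ofCoeffs]
  refine (ae_eval_ne_zero h_meas h_indep h_law h_cont
    (Matrix.det (Matrix.of fun i j => MvPolynomial.X (r, c, k, l, i, j)))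
    fun h0 => ?_).mono fun ω hω => ?_
  -- The determinant polynomial is nonzero because it takes the value `1` at the identity matrix.
  · have := hev fun y => (1 : Matrix (Fin M) (Fin M) ℂ) y.2.2.2.2.1 y.2.2.2.2.2
    rw [h0, map_zero] at this
    have h1 : Channel.ofCoeffs (K := K) (L := L)
        (fun y => (1 : Matrix (Fin M) (Fin M) ℂ) y.2.2.2.2.1 y.2.2.2.2.2) r c k l = 1 := rfl
    rw [h1, Matrix.det_one] at this
    exact zero_ne_one this
  · rwa [hev] at hω

end Random

end IMAC

theorem theorem6 {Ω : Type*} [MeasurableSpace Ω] (P : Measure Ω) [IsProbabilityMeasure P]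
    (K M L : ℕ) (hK : 0 < K) (hM : 0 < M) (hL : 0 < L)
    (h : IMAC.CoeffIndex K M L → Ω → ℂ)
    (h_meas : ∀ x, Measurable (h x))
    (h_indep : iIndepFun h P)
    (ν : Measure ℂ) (h_law : ∀ x, P.map (h x) = ν)
    (h_cont : ν ≪ (volume : Measure ℂ)) :
    ∀ᵐ ω ∂P,
      IsGreatest (IMAC.achievableCSS (IMAC.Channel.ofCoeffs fun x => h x ω))
        (if K ≤ M ^ 2 * L then 2 * (K : ℝ) * M * L / (K + 1)
          else 2 * (M : ℝ) ^ 3 * (L : ℝ) ^ 2 / ((M : ℝ) ^ 2 * L + 1)) ∧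
      IsGreatest (IMAC.achievableACS (IMAC.Channel.ofCoeffs fun x => h x ω))
        (if K ≤ 2 * M ^ 2 * L then 2 * (K : ℝ) * M * L / (K + 1)
          else 4 * (M : ℝ) ^ 3 * (L : ℝ) ^ 2 / (2 * (M : ℝ) ^ 2 * L + 1)) := by
  have : NeZero M := ⟨hM.ne'⟩
  have : NeZero L := ⟨hL.ne'⟩
  have : IsProbabilityMeasure ν := by
    rw [← h_law (0, 0, ⟨0, hK⟩, 0, 0, 0)]
    exact Measure.isProbabilityMeasure_map (h_meas _).aemeasurable
  have hD : 0 < M ^ 2 * L := by positivity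
  obtain ⟨w, p, hp, hw⟩ := IMAC.exists_generic_precoders_css (K := K) (M := M) (L := L)
    (min_le_left K (M ^ 2 * L)) (lt_min hK hD) (min_le_right _ _)
  obtain ⟨w', p', hp', hw'⟩ := IMAC.exists_generic_precoders_acs (K := K) (M := M) (L := L)
    (min_le_left K (2 * M ^ 2 * L)) (lt_min hK (by positivity)) (min_le_right _ _)
  filter_upwards [IMAC.ae_det_ne_zero h_meas h_indep h_law h_cont,
    IMAC.ae_eval_ne_zero h_meas h_indep h_law h_cont p hp,
    IMAC.ae_eval_reim_family_ne_zero h_meas h_indep h_law h_cont p' hp'] with ω h1 h2 h3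
  constructor
  · have key := IMAC.isGreatest_of_aligned (by rw [IMAC.finrank_blocks]) (min_le_left K (M ^ 2 * L))
      (IMAC.blockDiagonalLinear M L) (IMAC.Channel.joint (IMAC.Channel.ofCoeffs fun x => h x ω))
      (IMAC.joint_isUnit_det h1) (IMAC.exists_joint_eq h1) w (hw _ h2) one_pos
    convert key using 1
    · simp only [one_mul]
      rfl
    · split_ifs with hle
      · rw [min_eq_left hle]
        simp
        ring
      · rw [min_eq_right (not_le.1 hle).le]
        simp
        ring
  · have key := IMAC.isGreatest_of_aligned (by rw [IMAC.finrank_real_blocks])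
      (min_le_left K (2 * M ^ 2 * L)) (IMAC.realBlockDiagonalLinear M L)
      (fun r c k => IMAC.realForm (IMAC.Channel.joint (IMAC.Channel.ofCoeffs fun x => h x ω) r c k))
      (fun r c k => IMAC.isUnit_det_realForm (IMAC.joint_isUnit_det h1 r c k))
      (fun r c k => by
        obtain ⟨a, ha⟩ := IMAC.exists_joint_eq h1 r c k
        exact ⟨a, by rw [ha, IMAC.realForm_mul]; rfl⟩) w' (hw' _ h3) two_pos
    convert key using 1
    · rfl
    · split_ifs with hle
      · rw [min_eq_left hle]
        simp
        field_simp
      · rw [min_eq_right (not_le.1 hle).le]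
        simp
        field_simp
        ring
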